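/- Let $X$ be a metric space and $\varepsilon>0$. An $\varepsilon$-chain in $X$ is a finite sequence $\{x_0,\dots,x_n\}$ ($n\ge 0$) of points of $X$ with $d(x_{i},x_{i+1})<\varepsilon$ for all $0\le i<n$; it is an $\varepsilon$-loop if $x_n=x_0$. An $\varepsilon$-loop $\{x_0,\dots,x_n=x_0\}$ is $\varepsilon$-null if it can be transformed into the one-point loop $\{x_0\}$ in finitely many steps, each of which adds or removes a single point so that the result is again an $\varepsilon$-chain with the same endpoints. An $\varepsilon$-loop is $\varepsilon$-critical if it is not $\varepsilon$-null but is $\delta$-null for every $\delta>\varepsilon$, and $\varepsilon$ is a homotopy critical value of $X$ if $X$ contains an $\varepsilon$-critical $\varepsilon$-loop. The space $X$ is geodesic if any two points $x,y\in X$ are joined by a geodesic, that is, by a distance-preserving map $\gamma\colon[0,d(x,y)]\to X$ with $\gamma(0)=x$ and $\gamma(d(x,y))=y$. An essential $\varepsilon$-circle in a geodesic space $X$ is a set $C\subseteq X$ that is the image of an arclength parameterized loop $c\colon[0,3\varepsilon]\to X$ (that is, $c(0)=c(3\varepsilon)$ and $c|_{[s,t]}$ has length $t-s$ for all $0\le s\le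 t\le 3\varepsilon$) and that contains (all points of) an $\varepsilon$-loop that is not $\varepsilon$-null in $X$. Theorem. If $X$ is a compact geodesic space and $\varepsilon>0$, then $\varepsilon$ is a homotopy critical value of $X$ if and only if $X$ contains an essential $\varepsilon$-circle. -/

import Mathlib

namespace DiscreteHomotopy

variable {X : Type*} [MetricSpace X]

/-- A metric space is geodesic if any two points `x`, `y` are joined by a geodesic, that is, by an
arclength parameterized length minimizing curve. Such a curve is a distance preserving map from
`[0, d(x, y)]`. The map is given on `ℝ`, its values outside of the interval play no role. -/
def IsGeodesicSpace (X : Type*) [MetricSpace X] : Prop :=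
  ∀ x y : X, ∃ γ : ℝ → X, γ 0 = x ∧ γ (dist x y) = y ∧
    ∀ s ∈ Set.Icc 0 (dist x y), ∀ t ∈ Set.Icc 0 (dist x y), dist (γ s) (γ t) = |s - t|

/-- An `ε`-chain: a nonempty finite sequence `x₀, …, xₙ` with `d(xᵢ, xᵢ₊₁) < ε` for all `i`. -/
def IsEpsChain (ε : ℝ) (α : List X) : Prop :=
  α ≠ [] ∧ α.IsChain (fun x y => dist x y < ε)

/-- An `ε`-loop: an `ε`-chain `x₀, …, xₙ` with `xₙ = x₀`. -/
def IsEpsLoop (ε : ℝ) (α : List X) : Prop :=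
  IsEpsChain ε α ∧ α.head? = α.getLast?

/-- `β` arises from `α` by inserting one point (anywhere). -/
def InsertsPoint (α β : List X) : Prop :=
  ∃ (l₁ l₂ : List X) (x : X), α = l₁ ++ l₂ ∧ β = l₁ ++ x :: l₂

/-- `α` and `β` are `ε`-chains with the same endpoints that differ by a basic move: one arises from
the other by adding or removing a single point. -/
def BasicMove (ε : ℝ) (α β : List X) : Prop :=
  IsEpsChain ε α ∧ IsEpsChain ε β ∧ α.head? = β.head? ∧ α.getLast? = β.getLast? ∧
    (InsertsPoint α β ∨ InsertsPoint β α)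

/-- The `ε`-chain `α` is `ε`-homotopic to `β`: there is a finite sequence of basic moves, with fixed
endpoints and through `ε`-chains, from `α` to `β`. -/
def EpsHomotopic (ε : ℝ) (α β : List X) : Prop :=
  IsEpsChain ε α ∧ Relation.ReflTransGen (BasicMove ε) α β

/-- `α` is `ε`-null: it is an `ε`-loop that is `ε`-homotopic to the trivial loop at its first
point. -/
def IsEpsNull (ε : ℝ) (α : List X) : Prop :=
  IsEpsLoop ε α ∧ ∃ x : X, α.head? = some x ∧ EpsHomotopic ε α [x]

/-- An `ε`-loop is `ε`-critical if it is not `ε`-null but is `δ`-null for all `δ > ε`. -/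
def IsEpsCritical (ε : ℝ) (α : List X) : Prop :=
  IsEpsLoop ε α ∧ ¬ IsEpsNull ε α ∧ ∀ δ : ℝ, ε < δ → IsEpsNull δ α

/-- `ε` is a homotopy critical value of `X` if there is an `ε`-critical `ε`-loop in `X`. -/
def IsHomotopyCriticalValue (X : Type*) [MetricSpace X] (ε : ℝ) : Prop :=
  ∃ α : List X, IsEpsCritical ε α

/-- `c`, restricted to `[0, L]`, is an arclength parameterized loop of length `L`: the length of its
restriction to any `[s, t]` is `t - s`, and `c 0 = c L`. -/
def IsArclengthLoop (L : ℝ) (c : ℝ → X) : Prop :=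
  HasUnitSpeedOn c (Set.Icc 0 L) ∧ c 0 = c L

/-- `C` is an essential `ε`-circle: it is the image of an arclength parameterized loop of length
`3ε` and contains an `ε`-loop that is not `ε`-null in `X`. -/
def IsEssentialCircle (ε : ℝ) (C : Set X) : Prop :=
  (∃ c : ℝ → X, IsArclengthLoop (3 * ε) c ∧ C = c '' Set.Icc 0 (3 * ε)) ∧
    ∃ α : List X, IsEpsLoop ε α ∧ (∀ x ∈ α, x ∈ C) ∧ ¬ IsEpsNull ε α

end DiscreteHomotopy

/-! ### Calculus of `ε`-homotopies of chains. -/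

namespace DiscreteHomotopy

variable {X : Type*} [MetricSpace X] {ε : ℝ} {α β γ : List X}

/-! From a circle to a critical value: replace the curve by a 1-Lipschitz `c : ℝ → X` and let
`fourStep c t` represent its arc from `c 0` to `c t`. The loop `fourStep c (3 * ε)` is critical. For
`δ > ε` it deforms to the triangle `c 0`, `c ε`, `c (2ε)`, whose sides are at most `ε < δ`, and
collapses (`fourStep_null_of_lt`). Were it `ε`-null, any jump shorter than `ε` from `c s` to `c t`
could be traded for an arc, direct or complementary (`fourStep_append_chord`), so every `ε`-loop on
the circle would be `ε`-null.

From a critical value to a circle: for `δ ≤ 2ε`, inserting midpoints turns `δ`-chains into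
`ε`-chains, and `δ`-moves into passages across triangles with sides below `δ`. A loop that is
`δ`-null but not `ε`-null thus yields a subdivided triangle that is not `ε`-null
(`exists_not_triangleFills`). As `δ` decreases to `ε`, compactness gives a limit triangle. It is
still not null, since filling survives small perturbations (`TriangleFills.of_near`). A side shorter
than `ε` would fill it (`TriangleFills.of_exists_dist_lt`), so all sides equal `ε`, and geodesics
through its six points form the circle. -/

theorem BasicMove.symm (h : BasicMove ε α β) : BasicMove ε β α :=
  ⟨h.2.1, h.1, h.2.2.1.symm, h.2.2.2.1.symm, h.2.2.2.2.symm⟩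

namespace EpsHomotopic

theorem refl (h : IsEpsChain ε α) : EpsHomotopic ε α α := ⟨h, .refl⟩

theorem of_basicMove (h : BasicMove ε α β) : EpsHomotopic ε α β := ⟨h.1, .single h⟩

theorem trans (h : EpsHomotopic ε α β) (h' : EpsHomotopic ε β γ) : EpsHomotopic ε α γ :=
  ⟨h.1, h.2.trans h'.2⟩

theorem isEpsChain_right (h : EpsHomotopic ε α β) : IsEpsChain ε β := by
  rcases Relation.ReflTransGen.cases_tail h.2 with h' | ⟨γ, -, h'⟩
  · exact h' ▸ h.1
  · exact h'.2.1

theorem symm (h : EpsHomotopic ε α β) : EpsHomotopic ε β α :=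
  haveI : Std.Symm (BasicMove (X := X) ε) := ⟨fun _ _ hm => hm.symm⟩
  ⟨h.isEpsChain_right, Std.Symm.symm _ _ h.2⟩

/-- Moves fix endpoints, so the junctions with `l` and `r` never change. -/
theorem congr_append (h : EpsHomotopic ε α β) (l r : List X) (hc : IsEpsChain ε (l ++ α ++ r)) :
    EpsHomotopic ε (l ++ α ++ r) (l ++ β ++ r) := by
  obtain ⟨-, h⟩ := h
  induction h with
  | refl => exact refl hc
  | @tail β γ _ hm ih =>
    refine ih.trans (of_basicMove ?_)
    obtain ⟨hβ, hγ, hh, hl, hi⟩ := hm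
    have hc := ih.isEpsChain_right
    refine ⟨hc, ⟨by simp [hγ.1], ?_⟩, ?_, ?_, ?_⟩
    · have h2 := hc.2
      rw [List.isChain_append, List.isChain_append] at h2 ⊢
      simp only [List.getLast?_append, ← hh, ← hl] at h2 ⊢
      exact ⟨⟨h2.1.1, hγ.2, h2.1.2.2⟩, h2.2⟩
    · simp [List.head?_append, hh]
    · simp [List.getLast?_append, hl]
    · rcases hi with ⟨a, b, x, h1, h2⟩ | ⟨a, b, x, h1, h2⟩
      · exact .inl ⟨l ++ a, b ++ r, x, by simp [h1], by simp [h2]⟩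
      · exact .inr ⟨l ++ a, b ++ r, x, by simp [h1], by simp [h2]⟩

theorem append_right (h : EpsHomotopic ε α β) (r : List X) (hc : IsEpsChain ε (α ++ r)) :
    EpsHomotopic ε (α ++ r) (β ++ r) := by
  simpa using h.congr_append [] r (by simpa using hc)

theorem append_left (h : EpsHomotopic ε α β) (l : List X) (hc : IsEpsChain ε (l ++ α)) :
    EpsHomotopic ε (l ++ α) (l ++ β) := by
  simpa using h.congr_append l [] (by simpa using hc)

theorem erase (l r : List X) (a b c : X) (h : IsEpsChain ε (l ++ a :: b :: c :: r))
    (hac : dist a c < ε) : EpsHomotopic ε (l ++ a :: b :: c :: r) (l ++ a :: c :: r) := by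
  refine of_basicMove ⟨h, ⟨by simp, ?_⟩, ?_, ?_, .inr ⟨l ++ [a], c :: r, b, by simp, by simp⟩⟩
  · have h2 := h.2
    simp only [List.isChain_append, List.isChain_cons_cons, List.head?_cons] at h2 ⊢
    exact ⟨h2.1, ⟨hac, h2.2.1.2.2⟩, h2.2.2⟩
  · simp [List.head?_append]
  · simp [List.getLast?_append, List.getLast?_cons]

theorem insert (l r : List X) (a b c : X) (h : IsEpsChain ε (l ++ a :: c :: r))
    (hab : dist a b < ε) (hbc : dist b c < ε) :
    EpsHomotopic ε (l ++ a :: c :: r) (l ++ a :: b :: c :: r) := by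
  have h2 := h.2
  simp only [List.isChain_append, List.isChain_cons_cons, List.head?_cons] at h2
  refine (erase l r a b c ⟨by simp, ?_⟩ h2.2.1.1).symm
  simp only [List.isChain_append, List.isChain_cons_cons, List.head?_cons]
  exact ⟨h2.1, ⟨hab, hbc, h2.2.1.2⟩, h2.2.2⟩

theorem erase_dup (hε : 0 < ε) (l r : List X) (a : X) (h : IsEpsChain ε (l ++ a :: r)) :
    EpsHomotopic ε (l ++ a :: a :: r) (l ++ a :: r) := by
  have h1 : BasicMove ε [a] [a, a] := by
    refine ⟨by simp [IsEpsChain], by simp [IsEpsChain, hε], by simp, by simp,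
      .inl ⟨[], [a], a, by simp, by simp⟩⟩
  have := (of_basicMove h1).congr_append l r (by simpa using h)
  simpa using this.symm

end EpsHomotopic

open EpsHomotopic

/-- Two parallel chains, given as a list of pairs, are homotopic up to the first and the last rung
if their steps, rungs and diagonals are short. -/
theorem EpsHomotopic.ladder (l : List (X × X)) (p : X × X)
    (hl : (p :: l).IsChain
      (fun u v => dist u.1 v.1 < ε ∧ dist u.2 v.2 < ε ∧ dist u.1 v.2 < ε))
    (hd : ∀ u ∈ p :: l, dist u.1 u.2 < ε) :
    EpsHomotopic ε ((p :: l).map Prod.fst ++ [((p :: l).getLast (by simp)).2])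
      (p.1 :: (p :: l).map Prod.snd) := by
  induction l generalizing p with
  | nil =>
    have := hd p (by simp)
    exact refl ⟨by simp, by simpa using this⟩
  | cons q l ih =>
    rw [List.isChain_cons_cons] at hl
    have ih' := ih q hl.2 (fun u hu => hd u (List.mem_cons_of_mem _ hu))
    have hp := hd p (by simp)
    have hc : IsEpsChain ε ([p.1] ++ ((q :: l).map Prod.fst ++
        [((q :: l).getLast (by simp)).2])) := by
      refine ⟨by simp, ?_⟩
      have := ih'.1.2
      simp only [List.map_cons, List.cons_append, List.nil_append] at this ⊢
      exact List.isChain_cons_cons.2 ⟨hl.1.1, this⟩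
    have h1 := ih'.append_left [p.1] hc
    -- The diagonal from `p.1` to `q.2` allows `q.1` to be exchanged for `p.2`.
    have h2 := EpsHomotopic.erase [] (l.map Prod.snd) p.1 q.1 q.2
      (by simpa using h1.isEpsChain_right) hl.1.2.2
    have h3 := EpsHomotopic.insert [] (l.map Prod.snd) p.1 p.2 q.2
      h2.isEpsChain_right hp hl.1.2.1
    simpa using h1.trans (h2.trans h3)

/-- Going back along a chain and then along it again is null. -/
theorem EpsHomotopic.reverse_append (hε : 0 < ε) (l : List X) (a : X)
    (h : IsEpsChain ε (a :: l)) :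
    EpsHomotopic ε (l.reverse ++ a :: l) [(a :: l).getLast (by simp)] := by
  induction l generalizing a with
  | nil => exact refl h
  | cons b l ih =>
    have h2 := h.2
    rw [List.isChain_cons_cons] at h2
    have ih' := ih b ⟨by simp, h2.2⟩
    have h3 := EpsHomotopic.erase_dup hε l.reverse l b ih'.1
    have h4 := h3.1.2
    have h5 := EpsHomotopic.insert l.reverse l b a b h3.1 (by rw [dist_comm]; exact h2.1) h2.1
    simpa using h5.symm.trans (h3.trans ih')

end DiscreteHomotopy

/-! ### Chains on a closed curve of length `3ε`. -/

namespace DiscreteHomotopy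

variable {X : Type*} [MetricSpace X] {ε : ℝ} {α β γ : List X} {c : ℝ → X} {s t : ℝ}

open EpsHomotopic

/-- The chain along the curve `c` from `c 0` to `c t` with four steps of equal length. -/
noncomputable def fourStep (c : ℝ → X) (t : ℝ) : List X := [c 0, c (t / 4), c (t / 2), c (3 * t / 4), c t]

/-- Four steps keep each step at most `3ε/4`; with three it could equal `ε`. -/
theorem isEpsChain_fourStep_append (hc : ∀ s t, dist (c s) (c t) ≤ |s - t|) (hε : 0 < ε)
    (hs : s ∈ Set.Icc 0 (3 * ε)) {x : X} {l : List X} (hx : c s = x) (hl : IsEpsChain ε (x :: l)) :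
    IsEpsChain ε (fourStep c s ++ l) := by
  obtain ⟨hs0, hs1⟩ := hs
  subst hx
  have key : ∀ u v : ℝ, v - u = s / 4 → dist (c u) (c v) < ε := fun u v h => by
    refine (hc u v).trans_lt ?_
    rw [abs_lt]; constructor <;> linarith
  have h4 : IsEpsChain ε (c (3 * s / 4) :: c s :: l) :=
    ⟨by simp, List.isChain_cons_cons.2 ⟨key _ _ (by ring), hl.2⟩⟩
  refine ⟨by simp [fourStep], ?_⟩
  simp only [fourStep, List.cons_append, List.nil_append, List.isChain_cons_cons]
  exact ⟨key _ _ (by ring), key _ _ (by ring), key _ _ (by ring), List.isChain_cons_cons.1 h4.2⟩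

/-- The two arc chains form a ladder: its diagonals exceed a step, at most `3ε/4`, by less than
`ε/4`. -/
theorem fourStep_append_of_small (hc : ∀ s t, dist (c s) (c t) ≤ |s - t|) (hε : 0 < ε)
    (hs : s ∈ Set.Icc 0 (3 * ε)) (ht : t ∈ Set.Icc 0 (3 * ε)) (hst : |s - t| < ε / 4) :
    EpsHomotopic ε (fourStep c s ++ [c t]) (fourStep c t) := by
  obtain ⟨hs0, hs1⟩ := hs
  obtain ⟨ht0, ht1⟩ := ht
  rw [abs_lt] at hst
  have key : ∀ u v : ℝ, |u - v| < ε → dist (c u) (c v) < ε := fun u v h => (hc u v).trans_lt h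
  have h1 := EpsHomotopic.ladder (ε := ε)
    [(c (s / 4), c (t / 4)), (c (s / 2), c (t / 2)), (c (3 * s / 4), c (3 * t / 4)), (c s, c t)]
    (c 0, c 0)
    (by
      simp only [List.isChain_cons_cons, List.isChain_singleton, and_true]
      refine ⟨⟨?_, ?_, ?_⟩, ⟨?_, ?_, ?_⟩, ⟨?_, ?_, ?_⟩, ⟨?_, ?_, ?_⟩⟩ <;> apply key <;>
        rw [abs_lt] <;> constructor <;> linarith)
    (by
      simp only [List.forall_mem_cons]
      refine ⟨?_, ?_, ?_, ?_, ?_, by simp⟩ <;> apply key <;>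
        rw [abs_lt] <;> constructor <;> linarith)
  refine EpsHomotopic.trans h1 (EpsHomotopic.erase_dup hε [] _ _ ?_)
  have := isEpsChain_fourStep_append (l := []) hc hε ⟨ht0, ht1⟩ rfl (by simp [IsEpsChain])
  simpa [fourStep] using this

theorem fourStep_append_of_halves (hc : ∀ s t, dist (c s) (c t) ≤ |s - t|) (hε : 0 < ε) {η : ℝ}
    (hη : η ≤ ε / 2)
    (H : ∀ s ∈ Set.Icc 0 (3 * ε), ∀ t ∈ Set.Icc 0 (3 * ε), |s - t| < η →
      EpsHomotopic ε (fourStep c s ++ [c t]) (fourStep c t))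
    (hs : s ∈ Set.Icc 0 (3 * ε)) (ht : t ∈ Set.Icc 0 (3 * ε)) (hst : |s - t| < 2 * η) :
    EpsHomotopic ε (fourStep c s ++ [c t]) (fourStep c t) := by
  obtain ⟨hs0, hs1⟩ := id hs
  obtain ⟨ht0, ht1⟩ := id ht
  rw [abs_lt] at hst
  have hm : (s + t) / 2 ∈ Set.Icc 0 (3 * ε) := ⟨by linarith, by linarith⟩
  have hsm : |s - (s + t) / 2| < η := by rw [abs_lt]; constructor <;> linarith
  have hmt : |(s + t) / 2 - t| < η := by rw [abs_lt]; constructor <;> linarith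
  have d1 : dist (c s) (c ((s + t) / 2)) < ε := (hc _ _).trans_lt (by linarith)
  have d2 : dist (c ((s + t) / 2)) (c t) < ε := (hc _ _).trans_lt (by linarith)
  have d3 : dist (c s) (c t) < ε :=
    (hc _ _).trans_lt (by rw [abs_lt]; constructor <;> linarith)
  have h1 := EpsHomotopic.insert [c 0, c (s / 4), c (s / 2), c (3 * s / 4)] []
    (c s) (c ((s + t) / 2)) (c t)
    (isEpsChain_fourStep_append (l := [c t]) hc hε hs rfl (by simpa [IsEpsChain])) d1 d2
  have h2 := (H s hs _ hm hsm).append_right [c t] (by simpa [fourStep] using h1.isEpsChain_right)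
  exact EpsHomotopic.trans h1 (EpsHomotopic.trans (by simpa [fourStep] using h2) (H _ hm t ht hmt))

theorem fourStep_append (hc : ∀ s t, dist (c s) (c t) ≤ |s - t|) (hε : 0 < ε)
    (hs : s ∈ Set.Icc 0 (3 * ε)) (ht : t ∈ Set.Icc 0 (3 * ε)) (hst : |s - t| < ε) :
    EpsHomotopic ε (fourStep c s ++ [c t]) (fourStep c t) := by
  -- The admissible gap doubles twice, from `ε/4` to `ε/2` to `ε`.
  refine fourStep_append_of_halves hc hε le_rfl (fun s hs t ht h => ?_) hs ht (by linarith)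
  refine fourStep_append_of_halves hc hε (η := ε / 4) (by linarith) (fun s hs t ht h => ?_) hs ht
    (by linarith)
  exact fourStep_append_of_small hc hε hs ht h

/-- With the arc's midpoint kept in the chain, `c s` and `c t` need not be close. -/
theorem fourStep_append_pair (hc : ∀ s t, dist (c s) (c t) ≤ |s - t|) (hε : 0 < ε)
    (hs : s ∈ Set.Icc 0 (3 * ε)) (ht : t ∈ Set.Icc 0 (3 * ε)) (hst : |s - t| < 2 * ε) :
    EpsHomotopic ε (fourStep c s ++ [c ((s + t) / 2), c t]) (fourStep c t) := by
  obtain ⟨hs0, hs1⟩ := id hs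
  obtain ⟨ht0, ht1⟩ := id ht
  rw [abs_lt] at hst
  have hm : (s + t) / 2 ∈ Set.Icc 0 (3 * ε) := ⟨by linarith, by linarith⟩
  have hsm : |s - (s + t) / 2| < ε := by rw [abs_lt]; constructor <;> linarith
  have hmt : |(s + t) / 2 - t| < ε := by rw [abs_lt]; constructor <;> linarith
  have d1 := (hc _ _).trans_lt hsm
  have d2 := (hc _ _).trans_lt hmt
  have hch := isEpsChain_fourStep_append (l := [c ((s + t) / 2), c t]) hc hε hs rfl
    (by simpa [IsEpsChain] using ⟨d1, d2⟩)
  have h2 := (fourStep_append hc hε hs hm hsm).append_right [c t] (by simpa using hch)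
  exact EpsHomotopic.trans (by simpa using h2) (fourStep_append hc hε hm ht hmt)

theorem fourStep_append_chord_of_close (hc : ∀ s t, dist (c s) (c t) ≤ |s - t|) (hε : 0 < ε)
    (hs : s ∈ Set.Icc 0 (3 * ε)) (ht : t ∈ Set.Icc 0 (3 * ε)) (hst : |s - t| < 2 * ε)
    (hd : dist (c s) (c t) < ε) :
    EpsHomotopic ε (fourStep c s ++ [c t]) (fourStep c t) := by
  refine EpsHomotopic.trans ?_ (fourStep_append_pair hc hε hs ht hst)
  rw [abs_lt] at hst
  refine EpsHomotopic.insert [c 0, c (s / 4), c (s / 2), c (3 * s / 4)] [] _ _ _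
    (isEpsChain_fourStep_append (l := [c t]) hc hε hs rfl (by simpa [IsEpsChain]))
    ((hc _ _).trans_lt ?_) ((hc _ _).trans_lt ?_) <;> rw [abs_lt] <;> constructor <;> linarith

theorem fourStep_zero (c : ℝ → X) (hε : 0 < ε) :
    EpsHomotopic ε (fourStep c 0) [c 0] := by
  have h : IsEpsChain ε [c 0] := by simp [IsEpsChain]
  have h1 := EpsHomotopic.erase_dup hε [] [] (c 0) h
  have h2 := EpsHomotopic.erase_dup hε [] [c 0] (c 0) h1.1
  have h3 := EpsHomotopic.erase_dup hε [] [c 0, c 0] (c 0) h2.1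
  have h4 := EpsHomotopic.erase_dup hε [] [c 0, c 0, c 0] (c 0) h3.1
  simpa [fourStep] using h4.trans (h3.trans (h2.trans h1))

/-- Near the base point of a null loop, the chord across the base point is homotopic to the
long arc. -/
theorem fourStep_append_chord_of_far (hc : ∀ s t, dist (c s) (c t) ≤ |s - t|) (hε : 0 < ε)
    (hl : c 0 = c (3 * ε)) (hnull : EpsHomotopic ε (fourStep c (3 * ε)) [c 0])
    (hs : s ∈ Set.Icc 0 (3 * ε)) (ht : t ∈ Set.Icc 0 (3 * ε)) (hst : 2 * ε ≤ t - s)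
    (hd : dist (c s) (c t) < ε) :
    EpsHomotopic ε (fourStep c t ++ [c s]) (fourStep c s) := by
  obtain ⟨hs0, hs1⟩ := id hs
  obtain ⟨ht0, ht1⟩ := id ht
  have hL : 3 * ε ∈ Set.Icc 0 (3 * ε) := ⟨by linarith, le_rfl⟩
  have h0 : (0 : ℝ) ∈ Set.Icc 0 (3 * ε) := ⟨le_rfl, by linarith⟩
  set v := (t + 3 * ε) / 2 with hv
  set w := (0 + s) / 2 with hw
  have key : ∀ u v : ℝ, |u - v| < ε → dist (c u) (c v) < ε := fun u v h => (hc u v).trans_lt h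
  have dtv : dist (c t) (c v) < ε := key _ _ (by rw [abs_lt]; constructor <;> linarith)
  have dv0 : dist (c v) (c 0) < ε := by
    rw [hl]; exact key _ _ (by rw [abs_lt]; constructor <;> linarith)
  have d0w : dist (c 0) (c w) < ε := key _ _ (by rw [abs_lt]; constructor <;> linarith)
  have dws : dist (c w) (c s) < ε := key _ _ (by rw [abs_lt]; constructor <;> linarith)
  -- These estimates run along the complementary arc, over the base point.
  have cross : ∀ x ∈ Set.Icc 0 (3 * ε), ∀ y ∈ Set.Icc 0 (3 * ε), (3 * ε - y) + x < ε →
      dist (c y) (c x) < ε := fun x hx y hy hxy => by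
    have h1 := hc y (3 * ε)
    have h2 := hc 0 x
    rw [← hl, abs_of_nonpos (by linarith [hy.2])] at h1
    rw [abs_of_nonpos (by linarith [hx.1])] at h2
    linarith [dist_triangle (c y) (c 0) (c x)]
  have hvI : v ∈ Set.Icc 0 (3 * ε) := ⟨by linarith, by linarith⟩
  have hwI : w ∈ Set.Icc 0 (3 * ε) := ⟨by linarith, by linarith⟩
  have dvw : dist (c v) (c w) < ε := cross w hwI v hvI (by linarith)
  have hcv : IsEpsChain ε (fourStep c t ++ [c v, c 0, c w, c s]) :=
    isEpsChain_fourStep_append hc hε ht rfl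
      (by simpa [IsEpsChain] using ⟨dtv, dv0, d0w, dws⟩)
  have around : EpsHomotopic ε (fourStep c t ++ [c v, c 0, c w, c s]) (fourStep c s) := by
    -- Completing the arc to `3 * ε` gives the full loop, which is null; the chain then starts
    -- afresh from `c 0` towards `c s`.
    have h1 := (fourStep_append_pair hc hε ht hL
      (by rw [abs_lt]; constructor <;> linarith)).trans hnull
    rw [← hv, ← hl] at h1
    have h2 := h1.append_right [c w, c s] (by simpa using hcv)
    have h3 := (fourStep_zero c hε).symm.append_right [c w, c s]
      (by simpa [IsEpsChain] using ⟨d0w, dws⟩)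
    have h4 := fourStep_append_pair hc hε h0 hs (by rw [abs_lt]; constructor <;> linarith)
    rw [← hw] at h4
    exact EpsHomotopic.trans (by simpa using h2) (EpsHomotopic.trans (by simpa using h3) h4)
  refine EpsHomotopic.trans ?_ around
  set p := [c 0, c (t / 4), c (t / 2), c (3 * t / 4)] with hp
  have hp' : ∀ l, fourStep c t ++ l = p ++ c t :: l := fun l => by simp [hp, fourStep]
  rw [hp'] at hcv
  rw [hp', hp']
  have e1 := EpsHomotopic.erase (p ++ [c t]) [c s] (c v) (c 0) (c w) (by simpa using hcv) dvw
  simp only [List.append_assoc, List.cons_append, List.nil_append] at e1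
  refine EpsHomotopic.trans ?_ e1.symm
  rw [dist_comm] at hd
  -- The complementary arc may have length exactly `ε`, so the order in which `c v` and `c w` are
  -- removed depends on where the base point lies on it.
  rcases le_total s (ε / 2) with h | h
  · have dvs : dist (c v) (c s) < ε := cross s hs v hvI (by linarith)
    have e2 := EpsHomotopic.erase (p ++ [c t]) [] (c v) (c w) (c s)
      (by simpa using e1.isEpsChain_right) dvs
    simp only [List.append_assoc, List.cons_append, List.nil_append] at e2
    exact ((e2.trans (EpsHomotopic.erase p [] (c t) (c v) (c s) e2.isEpsChain_right hd))).symm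
  · have dtw : dist (c t) (c w) < ε := cross w hwI t ht (by linarith)
    have e2 := EpsHomotopic.erase p [c s] (c t) (c v) (c w) e1.isEpsChain_right dtw
    exact ((e2.trans (EpsHomotopic.erase p [] (c t) (c w) (c s) e2.isEpsChain_right hd))).symm

theorem fourStep_append_chord (hc : ∀ s t, dist (c s) (c t) ≤ |s - t|) (hε : 0 < ε)
    (hl : c 0 = c (3 * ε)) (hnull : EpsHomotopic ε (fourStep c (3 * ε)) [c 0])
    (hs : s ∈ Set.Icc 0 (3 * ε)) (ht : t ∈ Set.Icc 0 (3 * ε))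
    (hd : dist (c s) (c t) < ε) :
    EpsHomotopic ε (fourStep c s ++ [c t]) (fourStep c t) := by
  rcases lt_or_ge (|s - t|) (2 * ε) with h | h
  · exact fourStep_append_chord_of_close hc hε hs ht h hd
  rcases le_abs'.1 h with h | h
  · have hd' := hd
    rw [dist_comm] at hd'
    have h1 := fourStep_append_chord_of_far hc hε hl hnull hs ht (by linarith) hd
    have hc2 : IsEpsChain ε (fourStep c t ++ [c s, c t]) :=
      isEpsChain_fourStep_append hc hε ht rfl (by simpa [IsEpsChain] using ⟨hd', hd⟩)
    have h2 := h1.append_right [c t] (by simpa using hc2)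
    set p := [c 0, c (t / 4), c (t / 2), c (3 * t / 4)] with hp
    have h3 := EpsHomotopic.erase p [] (c t) (c s) (c t) hc2 (by simpa using hε)
    have hct := isEpsChain_fourStep_append (l := []) hc hε ht rfl (by simp [IsEpsChain])
    have h4 := EpsHomotopic.erase_dup hε p [] (c t) (by simpa [fourStep, hp] using hct)
    refine EpsHomotopic.trans h2.symm (EpsHomotopic.trans ?_ h4)
    simpa [fourStep, hp] using h3
  · rw [dist_comm] at hd
    exact fourStep_append_chord_of_far hc hε hl hnull ht hs (by linarith) hd

/-- The arc chain absorbs the points of `l` one at a time. -/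
theorem fourStep_append_map (hc : ∀ s t, dist (c s) (c t) ≤ |s - t|) (hε : 0 < ε)
    (hl : c 0 = c (3 * ε)) (hnull : EpsHomotopic ε (fourStep c (3 * ε)) [c 0])
    (l : List ℝ) (s : ℝ) (hs : ∀ t ∈ s :: l, t ∈ Set.Icc 0 (3 * ε))
    (hch : IsEpsChain ε ((s :: l).map c)) :
    EpsHomotopic ε (fourStep c s ++ l.map c) (fourStep c ((s :: l).getLast (by simp))) := by
  induction l generalizing s with
  | nil =>
    simpa using EpsHomotopic.refl
      (isEpsChain_fourStep_append (l := []) hc hε (hs s (by simp)) rfl (by simp [IsEpsChain]))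
  | cons t l ih =>
    have hch' := hch.2
    simp only [List.map_cons, List.isChain_cons_cons] at hch'
    have h1 := fourStep_append_chord hc hε hl hnull (hs s (by simp)) (hs t (by simp)) hch'.1
    have h2 := h1.append_right (l.map c) (by
      simpa using isEpsChain_fourStep_append (l := (t :: l).map c) hc hε (hs s (by simp)) rfl hch)
    have h3 := ih t (fun u hu => hs u (List.mem_cons_of_mem _ hu))
      ⟨by simp, by simpa using hch'.2⟩
    simpa using h2.trans h3

/-- If a closed curve of length `3ε` is `ε`-null then so are all `ε`-loops on it. -/
theorem isEpsNull_of_fourStep (hc : ∀ s t, dist (c s) (c t) ≤ |s - t|) (hε : 0 < ε)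
    (hl : c 0 = c (3 * ε)) (hnull : EpsHomotopic ε (fourStep c (3 * ε)) [c 0])
    (hα : IsEpsLoop ε α) (hmem : ∀ x ∈ α, x ∈ c '' Set.Icc 0 (3 * ε)) : IsEpsNull ε α := by
  refine ⟨hα, ?_⟩
  obtain ⟨hch, hends⟩ := hα
  -- The parameter depends only on the point, so the two ends of the loop get the same one, even at
  -- `c 0 = c (3 * ε)`.
  choose! τ hτ hτc using hmem
  cases α with
  | nil => exact absurd rfl hch.1
  | cons x l =>
    refine ⟨x, rfl, ?_⟩
    have hmap : (l.map τ).map c = l := by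
      rw [List.map_map]
      conv_rhs => rw [← List.map_id l]
      exact List.map_congr_left fun y hy => hτc y (List.mem_cons_of_mem _ hy)
    have hx := hτc x (by simp)
    have hlast : (τ x :: l.map τ).getLast (by simp) = τ x := by
      have h1 : (x :: l).getLast (by simp) = x := by
        rw [List.getLast?_eq_getLast_of_ne_nil (by simp)] at hends
        simpa using hends.symm
      have h2 := List.getLast_map (f := τ) (l := x :: l) (by simp)
      rw [h1] at h2
      exact h2
    have h1 := fourStep_append_map hc hε hl hnull (l.map τ) (τ x)
      (by
        intro t ht
        rw [← List.map_cons, List.mem_map] at ht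
        obtain ⟨y, hy, rfl⟩ := ht
        exact hτ y hy)
      (by rw [List.map_cons, hmap, hx]; exact hch)
    rw [hlast, hmap] at h1
    -- The loop is conjugated by the arc chain from `c 0` to `x`, which absorbs it; then the arc
    -- chain cancels.
    set q := [c (τ x / 4), c (τ x / 2), c (3 * τ x / 4), c (τ x)] with hq
    have hP : fourStep c (τ x) = c 0 :: q := rfl
    have hback := EpsHomotopic.reverse_append hε q (c 0) (hP ▸ h1.isEpsChain_right)
    have hqx : (c 0 :: q).getLast (by simp) = x := by simp [hq, hx]
    rw [hqx] at hback
    have hc3 : IsEpsChain ε (q.reverse ++ (c 0 :: q) ++ l) := by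
      have e1 := hback.1
      obtain ⟨r, hr⟩ : ∃ r, q.reverse ++ c 0 :: q = r ++ [x] :=
        ⟨q.reverse ++ [c 0, c (τ x / 4), c (τ x / 2), c (3 * τ x / 4)], by simp [hq, hx]⟩
      rw [hr] at e1 ⊢
      refine ⟨by simp, ?_⟩
      have e2 := hch.2
      have e3 := e1.2
      rw [List.append_assoc, List.isChain_append]
      rw [List.isChain_append] at e3
      exact ⟨e3.1, e2, by simpa using e3.2.2⟩
    have h2 := hback.append_right l hc3
    have h3 := h1.append_left q.reverse (by rw [hP]; simpa using hc3)
    rw [hP] at h3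
    exact EpsHomotopic.trans h2.symm (EpsHomotopic.trans (by simpa using h3) hback)

/-- The quarter points are exchanged for the third points, which form a triangle with sides at most
`ε < δ`. -/
theorem fourStep_null_of_lt (hc : ∀ s t, dist (c s) (c t) ≤ |s - t|) (hε : 0 < ε)
    (hl : c 0 = c (3 * ε)) {δ : ℝ} (hδ : ε < δ) :
    EpsHomotopic δ (fourStep c (3 * ε)) [c 0] := by
  have key : ∀ u v : ℝ, |u - v| ≤ ε → dist (c u) (c v) < δ := fun u v h =>
    ((hc u v).trans h).trans_lt hδ
  have d : ∀ u v : ℝ, u - v ≤ ε → v - u ≤ ε → dist (c u) (c v) < δ := fun u v h1 h2 =>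
    key u v (by rw [abs_le]; constructor <;> linarith)
  have h0 : IsEpsChain δ (fourStep c (3 * ε)) := by
    simp only [IsEpsChain, fourStep, List.isChain_cons_cons, List.isChain_singleton, and_true]
    refine ⟨by simp, ?_, ?_, ?_, ?_⟩ <;> apply d <;> linarith
  have h1 := EpsHomotopic.insert [c 0] [c (3 * (3 * ε) / 4), c (3 * ε)] (c (3 * ε / 4)) (c ε)
    (c (3 * ε / 2)) h0 (d _ _ (by linarith) (by linarith)) (d _ _ (by linarith) (by linarith))
  have h2 := EpsHomotopic.erase [] [c (3 * ε / 2), c (3 * (3 * ε) / 4), c (3 * ε)] (c 0)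
    (c (3 * ε / 4)) (c ε) h1.isEpsChain_right (d _ _ (by linarith) (by linarith))
  have h3 := EpsHomotopic.insert [c 0, c ε] [c (3 * ε)] (c (3 * ε / 2)) (c (2 * ε))
    (c (3 * (3 * ε) / 4)) h2.isEpsChain_right
    (d _ _ (by linarith) (by linarith)) (d _ _ (by linarith) (by linarith))
  have h4 := EpsHomotopic.erase [c 0] [c (3 * (3 * ε) / 4), c (3 * ε)] (c ε)
    (c (3 * ε / 2)) (c (2 * ε)) h3.isEpsChain_right (d _ _ (by linarith) (by linarith))
  have h5 := EpsHomotopic.erase [c 0, c ε] [] (c (2 * ε)) (c (3 * (3 * ε) / 4))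
    (c (3 * ε)) h4.isEpsChain_right (d _ _ (by linarith) (by linarith))
  have h6 := EpsHomotopic.erase [c 0] [] (c ε) (c (2 * ε)) (c (3 * ε)) h5.isEpsChain_right
    (by rw [← hl]; exact d _ _ (by linarith) (by linarith))
  have h7 := EpsHomotopic.erase [] [] (c 0) (c ε) (c (3 * ε)) h6.isEpsChain_right
    (by rw [← hl, dist_self]; linarith)
  have h8 := EpsHomotopic.erase_dup (hε.trans hδ) [] [] (c 0) (by simp [IsEpsChain])
  rw [← hl] at h1 h2 h3 h4 h5 h6 h7
  have := h1.trans (h2.trans (h3.trans (h4.trans (h5.trans (h6.trans (h7.trans h8))))))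
  rw [fourStep, ← hl]
  exact this

theorem IsArclengthLoop.exists_lipschitz {L : ℝ} (hL : 0 ≤ L) (h : IsArclengthLoop L c) :
    ∃ c' : ℝ → X, (∀ s t, dist (c' s) (c' t) ≤ |s - t|) ∧ c' 0 = c' L ∧
      c' '' Set.Icc 0 L = c '' Set.Icc 0 L := by
  have h1 : ∀ s ∈ Set.Icc 0 L, ∀ t ∈ Set.Icc 0 L, dist (c s) (c t) ≤ |s - t| := by
    have aux : ∀ s ∈ Set.Icc 0 L, ∀ t ∈ Set.Icc 0 L, s ≤ t → dist (c s) (c t) ≤ |s - t| := by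
      intro s hs t ht hst
      have h2 := h.1 hs ht
      have h3 := eVariationOn.edist_le c (s := Set.Icc 0 L ∩ Set.Icc s t)
        ⟨hs, Set.left_mem_Icc.2 hst⟩ ⟨ht, Set.right_mem_Icc.2 hst⟩
      rw [h2, edist_dist, ENNReal.ofReal_le_ofReal_iff (by simpa using hst)] at h3
      rw [abs_of_nonpos (by linarith)]
      simpa using h3
    intro s hs t ht
    rcases le_total s t with hst | hst
    · exact aux s hs t ht hst
    · rw [dist_comm, abs_sub_comm]; exact aux t ht s hs hst
  have hp : ∀ u ∈ Set.Icc 0 L, (Set.projIcc 0 L hL u : ℝ) = u := fun u hu => by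
    rw [Set.projIcc_of_mem hL hu]
  refine ⟨fun t => c (Set.projIcc 0 L hL t), fun s t => ?_, ?_, ?_⟩
  · refine (h1 _ (Set.projIcc 0 L hL s).2 _ (Set.projIcc 0 L hL t).2).trans ?_
    exact Set.abs_projIcc_sub_projIcc hL
  · simp only [hp 0 ⟨le_rfl, hL⟩, hp L ⟨hL, le_rfl⟩, h.2]
  · exact Set.image_congr fun u hu => by simp only [hp u hu]

theorem isHomotopyCriticalValue_of_isEssentialCircle (hε : 0 < ε) {C : Set X}
    (hC : IsEssentialCircle ε C) : IsHomotopyCriticalValue X ε := by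
  obtain ⟨⟨c, hc, rfl⟩, α, hα, hmem, hnot⟩ := hC
  obtain ⟨f, hf, hfl, himg⟩ := hc.exists_lipschitz (by linarith)
  rw [← himg] at hmem
  have hloop : (fourStep f (3 * ε)).head? = (fourStep f (3 * ε)).getLast? := by
    simp [fourStep, ← hfl]
  have hch : IsEpsChain ε (fourStep f (3 * ε)) := by
    simpa using isEpsChain_fourStep_append (l := []) hf hε (s := 3 * ε) ⟨by linarith, le_rfl⟩ rfl
      (by simp [IsEpsChain])
  refine ⟨fourStep f (3 * ε), ⟨hch, hloop⟩, fun hn => ?_, fun δ hδ => ?_⟩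
  · obtain ⟨-, x, hx, hh⟩ := hn
    obtain rfl : f 0 = x := by simpa [fourStep] using hx
    exact hnot (isEpsNull_of_fourStep hf hε hfl hh hα hmem)
  · have := fourStep_null_of_lt hf hε hfl hδ
    exact ⟨⟨this.1, hloop⟩, f 0, rfl, this⟩

end DiscreteHomotopy

/-! ### Midpoint subdivision and triangles that do not fill. -/

namespace DiscreteHomotopy

variable {X : Type*} [MetricSpace X] {ε δ : ℝ} {α β γ : List X}

theorem EpsHomotopic.spur (hε : 0 < ε) (l r : List X) (a b : X) (h : IsEpsChain ε (l ++ a :: r))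
    (hab : dist a b < ε) : EpsHomotopic ε (l ++ a :: r) (l ++ a :: b :: a :: r) := by
  have h1 := (EpsHomotopic.erase_dup hε l r a h).symm
  exact h1.trans (EpsHomotopic.insert l r a b a h1.isEpsChain_right hab (by rwa [dist_comm]))

/-- The subdivided triangle with vertices `a`, `x`, `b` and further points `m`, `m'`, `m''` on its
sides is `ε`-null. -/
def TriangleFills (ε : ℝ) (a m x m' b m'' : X) : Prop :=
  EpsHomotopic ε [a, m, x, m', b] [a, m'', b]

namespace TriangleFills

variable {a m x m' b m'' : X}

/-- Insert the spur `a, m'', b, m'', a` at the end of `x, m, a`, push its outgoing half across the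
triangle, and cancel the backtrack to `x`. -/
theorem rotate (hε : 0 < ε) (h : TriangleFills ε a m x m' b m'') :
    TriangleFills ε x m' b m'' a m := by
  obtain ⟨d1, d2, d3, d4⟩ :
      dist a m < ε ∧ dist m x < ε ∧ dist x m' < ε ∧ dist m' b < ε := by
    simpa [IsEpsChain] using h.1
  obtain ⟨d5, d6⟩ : dist a m'' < ε ∧ dist m'' b < ε := by
    simpa [IsEpsChain] using h.isEpsChain_right
  have d1' : dist m a < ε := by rwa [dist_comm]
  have d2' : dist x m < ε := by rwa [dist_comm]
  have d5' : dist m'' a < ε := by rwa [dist_comm]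
  have d6' : dist b m'' < ε := by rwa [dist_comm]
  have h1 := EpsHomotopic.spur hε [x, m] [] a m'' (by simp [IsEpsChain, *]) d5
  have h2 := EpsHomotopic.spur hε [x, m, a] [a] m'' b h1.isEpsChain_right d6
  have h3 := h.symm.congr_append [x, m] [m'', a] h2.isEpsChain_right
  have h4 := EpsHomotopic.erase [x] [x, m', b, m'', a] m a m h3.isEpsChain_right
    (by simpa using hε)
  have h5 := EpsHomotopic.erase [x] [m', b, m'', a] m m x h4.isEpsChain_right d2
  have h6 := EpsHomotopic.erase [] [m', b, m'', a] x m x h5.isEpsChain_right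
    (by simpa using hε)
  have h7 := EpsHomotopic.erase_dup hε [] [m', b, m'', a] x (by simp [IsEpsChain, *])
  exact (h1.trans (h2.trans (h3.trans (h4.trans (h5.trans (h6.trans h7)))))).symm

theorem of_null (hε : 0 < ε) (h : EpsHomotopic ε [a, m, x, m', b, m'', a] [a]) :
    TriangleFills ε a m x m' b m'' := by
  obtain ⟨d1, d2, d3, d4, d5, d6⟩ : dist a m < ε ∧ dist m x < ε ∧ dist x m' < ε ∧
      dist m' b < ε ∧ dist b m'' < ε ∧ dist m'' a < ε := by
    simpa [IsEpsChain] using h.1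
  have d5' : dist m'' b < ε := by rwa [dist_comm]
  have d6' : dist a m'' < ε := by rwa [dist_comm]
  have h1 := EpsHomotopic.spur hε [a, m, x, m'] [] b m'' (by simp [IsEpsChain, *]) d5
  have h2 := EpsHomotopic.spur hε [a, m, x, m', b] [b] m'' a h1.isEpsChain_right d6
  have h3 := h.append_right [m'', b] h2.isEpsChain_right
  exact h1.trans (h2.trans h3)

/-- Ladders carry both boundary paths from `v` to `w`; ladder steps and diagonals stay below `ε/2 +
2 * (ε/8) < ε`. -/
theorem of_near (hε : 0 < ε) {v w : Fin 6 → X} (hd : ∀ i, dist (v i) (w i) < ε / 8)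
    (hw : ∀ i, dist (w i) (w (i + 1)) ≤ ε / 2)
    (h : TriangleFills ε (w 0) (w 1) (w 2) (w 3) (w 4) (w 5)) :
    TriangleFills ε (v 0) (v 1) (v 2) (v 3) (v 4) (v 5) := by
  have dvw : ∀ i, dist (v i) (w i) < ε := fun i => by linarith [hd i]
  have dwv : ∀ i, dist (w i) (v i) < ε := fun i => by rw [dist_comm]; exact dvw i
  have key : ∀ i j, dist (w i) (w j) ≤ ε / 2 →
      dist (v i) (v j) < ε ∧ dist (w i) (w j) < ε ∧ dist (v i) (w j) < ε := fun i j hij => by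
    have h1 := dist_triangle (v i) (w i) (w j)
    have h2 := dist_triangle_right (v i) (v j) (w j)
    have := hd i
    have := hd j
    refine ⟨?_, ?_, ?_⟩ <;> linarith
  have hw' : ∀ i, dist (w (i + 1)) (w i) ≤ ε / 2 := fun i => by rw [dist_comm]; exact hw i
  have h1 := EpsHomotopic.ladder (ε := ε) [(v 1, w 1), (v 2, w 2), (v 3, w 3), (v 4, w 4)]
    (v 0, w 0)
    (by
      simp only [List.isChain_cons_cons, List.isChain_singleton, and_true]
      exact ⟨key 0 1 (hw 0), key 1 2 (hw 1), key 2 3 (hw 2), key 3 4 (hw 3)⟩)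
    (by simp [dvw])
  have h2 := EpsHomotopic.ladder (ε := ε) [(v 5, w 5), (v 4, w 4)] (v 0, w 0)
    (by
      simp only [List.isChain_cons_cons, List.isChain_singleton, and_true]
      exact ⟨key 0 5 (hw' 5), key 5 4 (hw' 4)⟩)
    (by simp [dvw])
  have h3 := h.append_left [v 0] h1.isEpsChain_right
  have h4 := (h1.trans (h3.trans h2.symm)).append_right [v 4] (by
    have := h1.1
    simp only [IsEpsChain, List.map_cons, List.map_nil, List.cons_append, List.nil_append,
      List.isChain_cons_cons, List.isChain_singleton, List.getLast_cons_cons,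
      List.getLast_singleton] at this ⊢
    simpa [dwv] using this)
  -- A ladder ends at `w 4`, so the spur through `w 4` is needed to return to `v 4`.
  have h5 := EpsHomotopic.spur hε [v 0, v 1, v 2, v 3] [] (v 4) (w 4) (by
    have := h1.1
    simp [IsEpsChain] at this ⊢
    tauto) (dvw 4)
  have h6 := EpsHomotopic.spur hε [v 0, v 5] [] (v 4) (w 4) (by
    have := h2.1
    simp [IsEpsChain] at this ⊢
    tauto) (dvw 4)
  exact h5.trans (EpsHomotopic.trans h4 h6.symm)

end TriangleFills

/-- Sliding slightly from `a` towards `m` makes a weak bound strict. -/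
theorem IsGeodesicSpace.exists_dist_le_dist_lt (hX : IsGeodesicSpace X) (a m : X) {η r : ℝ}
    (hη : 0 < η) (hr : 0 < r) (h : dist a m ≤ r) : ∃ p, dist a p ≤ η ∧ dist p m < r := by
  rcases dist_nonneg.eq_or_lt (a := (0 : ℝ)) (b := dist a m) with h0 | h0
  · exact ⟨a, by simpa using hη.le, by rwa [← h0]⟩
  obtain ⟨f, f0, f1, hf⟩ := hX a m
  have hs : min η (dist a m) ∈ Set.Icc 0 (dist a m) := ⟨le_min hη.le h0.le, min_le_right _ _⟩
  have hpos : 0 < min η (dist a m) := lt_min hη h0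
  have e1 := hf 0 ⟨le_rfl, h0.le⟩ _ hs
  have e2 := hf _ hs _ ⟨h0.le, le_rfl⟩
  rw [f0, zero_sub, abs_neg, abs_of_pos hpos] at e1
  rw [f1, abs_of_nonpos (by linarith [hs.2])] at e2
  refine ⟨f (min η (dist a m)), e1.trans_le (min_le_left _ _), by linarith⟩

theorem IsGeodesicSpace.exists_midpoint (hX : IsGeodesicSpace X) (a b : X) :
    ∃ m, dist a m = dist a b / 2 ∧ dist m b = dist a b / 2 := by
  obtain ⟨f, f0, f1, hf⟩ := hX a b
  have h0 := dist_nonneg (x := a) (y := b)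
  have hs : dist a b / 2 ∈ Set.Icc 0 (dist a b) := ⟨by linarith, by linarith⟩
  have e1 := hf 0 ⟨le_rfl, h0⟩ _ hs
  have e2 := hf _ hs _ ⟨h0, le_rfl⟩
  rw [f0, zero_sub, abs_neg, abs_of_nonneg hs.1] at e1
  rw [f1, abs_of_nonpos (by linarith)] at e2
  exact ⟨_, e1, by linarith⟩

/-- A subdivided triangle whose sides have length at most `ε` is null if a side is a chord of
length less than `ε`. -/
theorem TriangleFills.of_dist_lt (hX : IsGeodesicSpace X) (hε : 0 < ε) {a m x m' b m'' : X}
    (h1 : dist a m ≤ ε / 2) (h2 : dist m x ≤ ε / 2) (h3 : dist x m' ≤ ε / 2)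
    (h4 : dist m' b ≤ ε / 2) (h5 : dist b m'' ≤ ε / 2) (h6 : dist m'' a ≤ ε / 2)
    (hab : dist a b < ε) : TriangleFills ε a m x m' b m'' := by
  -- Sides `ax` and `xb` may have length `ε`, so `m` and `m'` are exchanged for `p` near `a` and `q`
  -- near `b`. Two displacements of `(ε - dist a b) / 3` keep `dist p q < ε`.
  have hη : 0 < min ((ε - dist a b) / 3) (ε / 4) := lt_min (by linarith) (by linarith)
  obtain ⟨p, hp1, hp2⟩ := hX.exists_dist_le_dist_lt a m hη (half_pos hε) h1
  obtain ⟨q, hq1, hq2⟩ := hX.exists_dist_le_dist_lt b m' hη (half_pos hε)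
    (by rwa [dist_comm])
  have hη1 := min_le_left ((ε - dist a b) / 3) (ε / 4)
  have hη2 := min_le_right ((ε - dist a b) / 3) (ε / 4)
  rw [dist_comm] at hq1 hq2 h5 h6
  have dpx : dist p x < ε := by linarith [dist_triangle p m x]
  have dxq : dist x q < ε := by linarith [dist_triangle x m' q]
  have daq : dist a q < ε := by linarith [dist_triangle_right a q b, dist_comm q b]
  have dpq : dist p q < ε := by
    linarith [dist_triangle_left p q a, dist_triangle_right a q b, dist_comm q b]
  have dap : dist a p < ε := by linarith
  have dpm : dist p m < ε := by linarith
  have dqb : dist q b < ε := by linarith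
  have dmq : dist m' q < ε := by linarith
  have e1 := EpsHomotopic.insert [] [x, m', b] a p m
    (by simp only [IsEpsChain, List.nil_append, List.isChain_cons_cons, List.isChain_singleton,
          and_true]
        refine ⟨by simp, ?_, ?_, ?_, ?_⟩ <;> linarith) dap dpm
  have e2 := EpsHomotopic.erase [a] [m', b] p m x e1.isEpsChain_right dpx
  have e3 := EpsHomotopic.insert [a, p, x] [] m' q b e2.isEpsChain_right dmq dqb
  have e4 := EpsHomotopic.erase [a, p] [b] x m' q e3.isEpsChain_right dxq
  have e5 := EpsHomotopic.erase [a] [b] p x q e4.isEpsChain_right dpq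
  have e6 := EpsHomotopic.erase [] [b] a p q e5.isEpsChain_right daq
  have e7 := EpsHomotopic.erase [] [] a q b e6.isEpsChain_right hab
  have e8 := EpsHomotopic.insert [] [] a m'' b e7.isEpsChain_right (by linarith) (by linarith)
  exact e1.trans (e2.trans (e3.trans (e4.trans (e5.trans (e6.trans (e7.trans e8))))))

theorem TriangleFills.of_exists_dist_lt (hX : IsGeodesicSpace X) (hε : 0 < ε)
    {a m x m' b m'' : X}
    (h1 : dist a m ≤ ε / 2) (h2 : dist m x ≤ ε / 2) (h3 : dist x m' ≤ ε / 2)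
    (h4 : dist m' b ≤ ε / 2) (h5 : dist b m'' ≤ ε / 2) (h6 : dist m'' a ≤ ε / 2)
    (h : dist a x < ε ∨ dist x b < ε ∨ dist b a < ε) : TriangleFills ε a m x m' b m'' := by
  rcases h with h | h | h
  · rw [dist_comm] at h
    exact ((TriangleFills.of_dist_lt hX hε h3 h4 h5 h6 h1 h2 h).rotate hε).rotate hε
  · rw [dist_comm] at h
    exact (TriangleFills.of_dist_lt hX hε h5 h6 h1 h2 h3 h4 h).rotate hε
  · rw [dist_comm] at h
    exact TriangleFills.of_dist_lt hX hε h1 h2 h3 h4 h5 h6 h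

/-- Insert the point `μ a b` between any two consecutive points `a`, `b`. -/
def subdivide (μ : X → X → X) : List X → List X
  | [] => []
  | [a] => [a]
  | a :: b :: l => a :: μ a b :: subdivide μ (b :: l)

theorem subdivide_cons {Y : Type*} (μ : Y → Y → Y) (a : Y) (l : List Y) :
    ∃ r, subdivide μ (a :: l) = a :: r := by
  cases l <;> simp [subdivide]

theorem exists_subdivide_append {Y : Type*} (μ : Y → Y → Y) (l : List Y) (a : Y) :
    ∃ s, ∀ r, subdivide μ (l ++ a :: r) = s ++ subdivide μ (a :: r) := by
  induction l with
  | nil => exact ⟨[], fun r => rfl⟩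
  | cons c l ih =>
    obtain ⟨s, hs⟩ := ih
    cases l with
    | nil => exact ⟨[c, μ c a], fun r => by simp [subdivide]⟩
    | cons d l => exact ⟨c :: μ c d :: s, fun r => by simpa [subdivide] using hs r⟩

section Subdivide

variable {μ : X → X → X} (hμ : ∀ a b, dist a (μ a b) = dist a b / 2 ∧
  dist (μ a b) b = dist a b / 2)

include hμ

theorem isEpsChain_subdivide (hδ : δ ≤ 2 * ε) (h : IsEpsChain δ α) :
    IsEpsChain ε (subdivide μ α) := by
  induction α with
  | nil => exact absurd rfl h.1
  | cons a l ih =>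
    cases l with
    | nil => simp [subdivide, IsEpsChain]
    | cons b l =>
      have h2 := List.isChain_cons_cons.1 h.2
      have ih' := ih ⟨by simp, h2.2⟩
      obtain ⟨r, hr⟩ := subdivide_cons μ b l
      obtain ⟨e1, e2⟩ := hμ a b
      rw [subdivide]
      rw [hr] at ih' ⊢
      exact ⟨by simp, List.isChain_cons_cons.2 ⟨by linarith [h2.1],
        List.isChain_cons_cons.2 ⟨by linarith [h2.1], ih'.2⟩⟩⟩

theorem epsHomotopic_subdivide (hε : 0 < ε) (h : IsEpsChain ε α) :
    EpsHomotopic ε (subdivide μ α) α := by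
  induction α with
  | nil => exact absurd rfl h.1
  | cons a l ih =>
    cases l with
    | nil => simpa [subdivide] using EpsHomotopic.refl h
    | cons b l =>
      have h2 := List.isChain_cons_cons.1 h.2
      have h3 := (ih ⟨by simp, h2.2⟩).append_left [a, μ a b]
        (isEpsChain_subdivide hμ (by linarith) h)
      exact h3.trans (EpsHomotopic.erase [] l a (μ a b) b h3.isEpsChain_right h2.1)

/-- An interior insertion crosses one triangle. At either end the fixed endpoint forces a repeated
point, which subdivides to a spur. -/
theorem subdivide_insertsPoint (hε : 0 < ε) (hδ : δ ≤ 2 * ε)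
    (hfill : ∀ a x b, dist a x < δ → dist x b < δ → dist a b < δ →
      TriangleFills ε a (μ a x) x (μ x b) b (μ a b))
    (hα : IsEpsChain δ α) (hβ : IsEpsChain δ β) (hh : α.head? = β.head?)
    (hl : α.getLast? = β.getLast?) (hi : InsertsPoint α β) :
    EpsHomotopic ε (subdivide μ α) (subdivide μ β) := by
  have hcα := isEpsChain_subdivide hμ hδ hα
  have hself : ∀ a, dist a (μ a a) < ε := fun a => by
    rw [(hμ a a).1, dist_self, zero_div]; exact hε
  obtain ⟨l₁, l₂, x, rfl, rfl⟩ := hi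
  rcases List.eq_nil_or_concat l₁ with rfl | ⟨l₁, a, rfl⟩
  · cases l₂ with
    | nil => exact absurd rfl hα.1
    | cons b l =>
      obtain rfl : b = x := by simpa using hh
      obtain ⟨r, hr⟩ := subdivide_cons μ b l
      simp only [List.nil_append, subdivide, hr] at hcα ⊢
      exact EpsHomotopic.spur hε [] r b _ hcα (hself b)
  · simp only [List.concat_eq_append, List.append_assoc, List.cons_append, List.nil_append]
      at hα hβ hl hcα ⊢
    obtain ⟨s, hs⟩ := exists_subdivide_append μ l₁ a
    rw [hs] at hcα
    rw [hs, hs]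
    cases l₂ with
    | nil =>
      obtain rfl : a = x := by simpa using hl
      exact EpsHomotopic.spur hε s [] a _ hcα (hself a)
    | cons b l =>
      obtain ⟨r, hr⟩ := subdivide_cons μ b l
      simp only [subdivide, hr] at hcα ⊢
      have hα2 := hα.2
      have hβ2 := hβ.2
      simp only [List.isChain_append, List.isChain_cons_cons] at hα2 hβ2
      have := (hfill a x b hβ2.2.1.1 hβ2.2.1.2.1 hα2.2.1.1).symm.congr_append s r
        (by simpa using hcα)
      simpa using this

/-- If all small triangles fill, then `δ`-homotopies of subdivided chains are `ε`-homotopies. -/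
theorem EpsHomotopic.subdivide (hε : 0 < ε) (hδ : δ ≤ 2 * ε)
    (hfill : ∀ a x b, dist a x < δ → dist x b < δ → dist a b < δ →
      TriangleFills ε a (μ a x) x (μ x b) b (μ a b))
    (h : EpsHomotopic δ α β) : EpsHomotopic ε (subdivide μ α) (subdivide μ β) := by
  obtain ⟨hα, h⟩ := h
  induction h with
  | refl => exact EpsHomotopic.refl (isEpsChain_subdivide hμ hδ hα)
  | tail _ hm ih =>
    obtain ⟨h1, h2, hh, hl, hi | hi⟩ := hm
    · exact ih.trans (subdivide_insertsPoint hμ hε hδ hfill h1 h2 hh hl hi)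
    · exact ih.trans (subdivide_insertsPoint hμ hε hδ hfill h2 h1 hh.symm hl.symm hi).symm

theorem exists_not_triangleFills (hε : 0 < ε) (hδ : δ ≤ 2 * ε) (hα : IsEpsLoop ε α)
    (hnot : ¬ IsEpsNull ε α) (hnull : IsEpsNull δ α) :
    ∃ a x b, dist a x < δ ∧ dist x b < δ ∧ dist a b < δ ∧
      ¬ TriangleFills ε a (μ a x) x (μ x b) b (μ a b) := by
  by_contra! hfill
  obtain ⟨-, x, hx, h⟩ := hnull
  exact hnot ⟨hα, x, hx, (epsHomotopic_subdivide hμ hε hα.1).symm.trans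
    (h.subdivide hμ hε hδ hfill)⟩

end Subdivide

/-- Small triangles that do not fill accumulate at an equilateral one with sides of length `ε`. -/
theorem exists_equilateral_not_triangleFills [CompactSpace X] (hX : IsGeodesicSpace X)
    (hε : 0 < ε) (hα : IsEpsCritical ε α) :
    ∃ w : Fin 6 → X, (∀ i, dist (w i) (w (i + 1)) = ε / 2) ∧
      ¬ TriangleFills ε (w 0) (w 1) (w 2) (w 3) (w 4) (w 5) := by
  choose μ hμ using hX.exists_midpoint
  -- Values below `2ε` keep the half-edges shorter than `ε`.
  obtain ⟨u, -, huI, hu⟩ := exists_seq_strictAnti_tendsto' (show ε < 2 * ε by linarith)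
  have hbad : ∀ n, ∃ v : Fin 6 → X, (∀ i, dist (v i) (v (i + 1)) ≤ u n / 2) ∧
      ¬ TriangleFills ε (v 0) (v 1) (v 2) (v 3) (v 4) (v 5) := fun n => by
    obtain ⟨a, x, b, h1, h2, h3, h⟩ := exists_not_triangleFills hμ hε (huI n).2.le hα.1 hα.2.1
      (hα.2.2 _ (huI n).1)
    refine ⟨![a, μ a x, x, μ x b, b, μ a b], ?_, h⟩
    have e1 := hμ a x
    have e2 := hμ x b
    have e3 := hμ a b
    simp only [Fin.forall_fin_succ, IsEmpty.forall_iff, and_true]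
    refine ⟨?_, ?_, ?_, ?_, ?_, ?_⟩
    · exact e1.1.trans_le (by linarith)
    · exact e1.2.trans_le (by linarith)
    · exact e2.1.trans_le (by linarith)
    · exact e2.2.trans_le (by linarith)
    · exact (dist_comm _ _).trans_le (e3.2.trans_le (by linarith))
    · exact (dist_comm _ _).trans_le (e3.1.trans_le (by linarith))
  choose v hv hvbad using hbad
  obtain ⟨w, φ, hφ, hw⟩ := SeqCompactSpace.tendsto_subseq v
  have hwi := fun i => (tendsto_pi_nhds.1 hw) i
  have hle : ∀ i, dist (w i) (w (i + 1)) ≤ ε / 2 := fun i =>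
    le_of_tendsto_of_tendsto' ((hwi i).dist (hwi (i + 1)))
      ((hu.comp hφ.tendsto_atTop).div_const 2) fun n => hv (φ n) i
  obtain ⟨n, hn⟩ := (Filter.eventually_all.2 fun i =>
    Metric.tendsto_nhds.1 (hwi i) (ε / 8) (by linarith)).exists
  have hbad : ¬ TriangleFills ε (w 0) (w 1) (w 2) (w 3) (w 4) (w 5) := fun h =>
    hvbad (φ n) (TriangleFills.of_near hε hn hle h)
  refine ⟨w, ?_, hbad⟩
  have h0 := hle 0
  have h1 := hle 1
  have h2 := hle 2
  have h3 := hle 3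
  have h4 := hle 4
  have h5 := hle 5
  -- Each side is at least `ε` while its two halves are at most `ε/2`, so equality holds throughout.
  have hno := mt (TriangleFills.of_exists_dist_lt hX hε h0 h1 h2 h3 h4 h5) hbad
  push Not at hno
  obtain ⟨n1, n2, n3⟩ := hno
  have t1 := n1.trans (dist_triangle (w 0) (w 1) (w 2))
  have t2 := n2.trans (dist_triangle (w 2) (w 3) (w 4))
  have t3 := n3.trans (dist_triangle (w 4) (w 5) (w 0))
  simp only [Fin.forall_fin_succ, IsEmpty.forall_iff, and_true]
  refine ⟨le_antisymm h0 ?_, le_antisymm h1 ?_, le_antisymm h2 ?_, le_antisymm h3 ?_,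
    le_antisymm h4 ?_, le_antisymm h5 ?_⟩
  · exact (show ε / 2 ≤ dist (w 0) (w 1) from by linarith [show dist (w 1) (w 2) ≤ ε / 2 from h1])
  · exact (show ε / 2 ≤ dist (w 1) (w 2) from by linarith [show dist (w 0) (w 1) ≤ ε / 2 from h0])
  · exact (show ε / 2 ≤ dist (w 2) (w 3) from by linarith [show dist (w 3) (w 4) ≤ ε / 2 from h3])
  · exact (show ε / 2 ≤ dist (w 3) (w 4) from by linarith [show dist (w 2) (w 3) ≤ ε / 2 from h2])
  · exact (show ε / 2 ≤ dist (w 4) (w 5) from by linarith [show dist (w 5) (w 0) ≤ ε / 2 from h5])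
  · exact (show ε / 2 ≤ dist (w 5) (w 0) from by linarith [show dist (w 4) (w 5) ≤ ε / 2 from h4])

end DiscreteHomotopy

/-! ### Joining geodesics into an arclength parameterized loop. -/

namespace DiscreteHomotopy

variable {X : Type*} [MetricSpace X] {ε : ℝ}

/-- Every variation sum of `f` equals that of the identity. -/
theorem hasUnitSpeedOn_of_dist_eq {f : ℝ → X} {s : Set ℝ}
    (h : ∀ x ∈ s, ∀ y ∈ s, dist (f x) (f y) = |x - y|) : HasUnitSpeedOn f s := by
  rw [HasUnitSpeedOn, hasConstantSpeedOnWith_iff_ordered]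
  intro x hx y hy hxy
  have hy' : y ∈ s ∩ Set.Icc x y := ⟨hy, hxy, le_rfl⟩
  have hx' : x ∈ s ∩ Set.Icc x y := ⟨hx, le_rfl, hxy⟩
  refine le_antisymm ?_ ?_
  · have h1 : eVariationOn f (s ∩ Set.Icc x y) ≤ eVariationOn id (s ∩ Set.Icc x y) :=
      iSup_mono fun p => Finset.sum_le_sum fun i _ => by
        rw [edist_dist, edist_dist, h _ (p.2.2.2 _).1 _ (p.2.2.2 _).1, id, id, Real.dist_eq]
    have h2 := (monotone_id.monotoneOn (s ∩ Set.Icc x y)).eVariationOn_eq hx' hy'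
    have h3 : (s ∩ Set.Icc x y) ∩ Set.Icc x y = s ∩ Set.Icc x y := by
      rw [Set.inter_assoc, Set.inter_self]
    rw [h3] at h2
    simpa using h1.trans h2.le
  · have h1 := eVariationOn.edist_le f hx' hy'
    rw [edist_dist, h x hx y hy, abs_of_nonpos (by linarith)] at h1
    simpa using h1

theorem HasUnitSpeedOn.congr {f g : ℝ → X} {s : Set ℝ} (hf : HasUnitSpeedOn f s)
    (h : Set.EqOn f g s) : HasUnitSpeedOn g s := by
  intro x hx y hy
  rw [← hf hx hy]
  exact eVariationOn.eq_of_eqOn (h.symm.mono Set.inter_subset_left)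

theorem HasUnitSpeedOn.comp_sub {f : ℝ → X} {a b : ℝ} (hf : HasUnitSpeedOn f (Set.Icc a b))
    (L : ℝ) : HasUnitSpeedOn (fun t => f (t - L)) (Set.Icc (a + L) (b + L)) := by
  intro x hx y hy
  have h1 := eVariationOn.comp_eq_of_monotoneOn f (t := Set.Icc (a + L) (b + L) ∩ Set.Icc x y)
    (fun t => t - L) (fun u _ v _ huv => sub_le_sub_right huv L)
  rw [Set.Icc_inter_Icc, Set.image_sub_const_Icc, ← max_sub_sub_right, ← min_sub_sub_right,
    add_sub_cancel_right, add_sub_cancel_right, ← Set.Icc_inter_Icc, ← Set.Icc_inter_Icc,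
    hf ⟨by linarith [hx.1], by linarith [hx.2]⟩ ⟨by linarith [hy.1], by linarith [hy.2]⟩] at h1
  rw [sub_sub_sub_cancel_right] at h1
  exact h1

theorem exists_hasUnitSpeedOn_concat {f g : ℝ → X} {L M : ℝ} (hL : 0 ≤ L) (hM : 0 ≤ M)
    (hf : HasUnitSpeedOn f (Set.Icc 0 L)) (hg : HasUnitSpeedOn g (Set.Icc 0 M))
    (h : f L = g 0) : ∃ c : ℝ → X, HasUnitSpeedOn c (Set.Icc 0 (M + L)) ∧ c 0 = f 0 ∧
      c (M + L) = g M ∧ f '' Set.Icc 0 L ⊆ c '' Set.Icc 0 (M + L) ∧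
      g '' Set.Icc 0 M ⊆ c '' Set.Icc 0 (M + L) := by
  set c : ℝ → X := fun t => if t ≤ L then f t else g (t - L) with hc
  have hcf : Set.EqOn f c (Set.Icc 0 L) := fun t ht => by simp [hc, ht.2]
  have hcg : Set.EqOn (fun t => g (t - L)) c (Set.Icc (0 + L) (M + L)) := fun t ht => by
    rcases (show L ≤ t by linarith [ht.1]).eq_or_lt with rfl | h'
    · simp [hc, h]
    · simp [hc, not_le.2 h']
  have h1 := HasUnitSpeedOn.congr hf hcf
  have h2 := HasUnitSpeedOn.congr (HasUnitSpeedOn.comp_sub hg L) hcg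
  rw [zero_add] at h2
  refine ⟨c, HasConstantSpeedOnWith.Icc_Icc h1 h2, (hcf ⟨le_rfl, hL⟩).symm, ?_, ?_, ?_⟩
  · have := hcg (x := M + L) ⟨by linarith, le_rfl⟩
    simpa using this.symm
  · rintro _ ⟨t, ht, rfl⟩
    exact ⟨t, ⟨ht.1, by linarith [ht.2]⟩, (hcf ht).symm⟩
  · rintro _ ⟨t, ht, rfl⟩
    have := hcg (x := t + L) ⟨by linarith [ht.1], by linarith [ht.2]⟩
    exact ⟨t + L, ⟨by linarith [ht.1], by linarith [ht.2]⟩, by simpa using this.symm⟩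

/-- Lengths of consecutive geodesics add up, whether or not the concatenation is minimizing. -/
theorem IsGeodesicSpace.exists_hasUnitSpeedOn (hX : IsGeodesicSpace X) {h : ℝ} (hh : 0 ≤ h)
    (l : List X) (a : X) (hl : (a :: l).IsChain (fun x y => dist x y = h)) :
    ∃ c : ℝ → X, HasUnitSpeedOn c (Set.Icc 0 (l.length * h)) ∧ c 0 = a ∧
      c (l.length * h) = (a :: l).getLast (by simp) ∧
      ∀ x ∈ a :: l, x ∈ c '' Set.Icc 0 (l.length * h) := by
  induction l generalizing a with
  | nil =>
    refine ⟨fun _ => a, ?_, rfl, by simp, by simp⟩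
    exact hasConstantSpeedOnWith_of_subsingleton _ (by simp) _
  | cons b l ih =>
    rw [List.isChain_cons_cons] at hl
    obtain ⟨g, hg, hg0, hg1, hgm⟩ := ih b hl.2
    obtain ⟨f, hf0, hf1, hf⟩ := hX a b
    rw [hl.1] at hf1 hf
    obtain ⟨c, hc, hc0, hc1, hcf, hcg⟩ := exists_hasUnitSpeedOn_concat hh
      (mul_nonneg (Nat.cast_nonneg _) hh) (hasUnitSpeedOn_of_dist_eq hf) hg (hf1.trans hg0.symm)
    have hlen : (((b :: l).length : ℕ) : ℝ) * h = l.length * h + h := by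
      rw [List.length_cons]; push_cast; ring
    rw [hlen]
    refine ⟨c, hc, hc0.trans hf0, by rw [hc1, hg1, List.getLast_cons_cons], ?_⟩
    rw [List.forall_mem_cons]
    exact ⟨hcf ⟨0, ⟨le_rfl, hh⟩, hf0⟩, fun x hx => hcg (hgm x hx)⟩

theorem exists_isEssentialCircle [CompactSpace X] (hX : IsGeodesicSpace X) (hε : 0 < ε)
    (h : IsHomotopyCriticalValue X ε) : ∃ C : Set X, IsEssentialCircle ε C := by
  obtain ⟨α, hα⟩ := h
  obtain ⟨w, hw, hbad⟩ := exists_equilateral_not_triangleFills hX hε hα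
  have hchain : [w 0, w 1, w 2, w 3, w 4, w 5, w 0].IsChain (fun x y => dist x y = ε / 2) := by
    simp only [List.isChain_cons_cons, List.isChain_singleton, and_true]
    exact ⟨hw 0, hw 1, hw 2, hw 3, hw 4, hw 5⟩
  obtain ⟨c, hc, hc0, hc1, hcm⟩ := hX.exists_hasUnitSpeedOn (half_pos hε).le _ _ hchain
  have hlen : (([w 1, w 2, w 3, w 4, w 5, w 0].length : ℕ) : ℝ) * (ε / 2) = 3 * ε := by
    simp only [List.length_cons, List.length_nil]; push_cast; ring
  rw [hlen] at hc hc1 hcm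
  refine ⟨c '' Set.Icc 0 (3 * ε), ⟨c, ⟨hc, hc0.trans hc1.symm⟩, rfl⟩,
    [w 0, w 1, w 2, w 3, w 4, w 5, w 0], ⟨⟨by simp, hchain.imp ?_⟩, by simp⟩, hcm, ?_⟩
  · intro x y hxy
    rw [hxy]; linarith
  · rintro ⟨-, x, hx, hn⟩
    obtain rfl : w 0 = x := by simpa using hx
    exact hbad (TriangleFills.of_null hε hn)

end DiscreteHomotopy

theorem theorem1p4 {X : Type*} [MetricSpace X] [CompactSpace X]
    (hX : DiscreteHomotopy.IsGeodesicSpace X) (ε : ℝ) (hε : 0 < ε) :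
    DiscreteHomotopy.IsHomotopyCriticalValue X ε ↔
      ∃ C : Set X, DiscreteHomotopy.IsEssentialCircle ε C :=
  ⟨DiscreteHomotopy.exists_isEssentialCircle hX hε,
    fun ⟨_, hC⟩ => DiscreteHomotopy.isHomotopyCriticalValue_of_isEssentialCircle hε hC⟩
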